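/- Let $S=(S,+,\cdot,0,1)$ be a semiring (addition commutative, multiplication associative with unit, two-sided distributivity, $0\cdot a=a\cdot 0=0$). Alphabets are finite and nonempty, and a power series over $S$ and an alphabet $\Sigma$ is a map $r\colon\Sigma^*\to S$. Then $\mathbf{FP}[S]\subseteq\mathbf{NP}[S]$, where the two classes of power series are defined as follows. **$\mathbf{NP}[S]$.** A weighted Turing machine over $S$ and $\Sigma$ is $\mathcal M=(Q,\Gamma,\Delta,\sigma,q_0,F,\square)$ with a finite set $Q$ of states, a finite working alphabet $\Gamma\supseteq\Sigma$, a blank $\square\in\Gamma\setminus\Sigma$, an initial state $q_0\in Q$, a set $F\subseteq Q$ of accepting states, a set of transitions $\Delta\subseteq(Q\setminus F)\times\Gamma\times Q\times(\Gamma\setminus\{\square\})\times\{-1,0,1\}$ and weights $\sigma\colon\Delta\to S\setminus\{0\}$. It has a single two-way infinite tape; $(p,c,q,d,s)\in\Delta$ permits it, in state $p$ reading $c$, to go to state $q$, write $d$ and move the head $s$ cells to the right. A computation on $w\in\Sigma^*$ is a finite sequence $\gamma=(C_0,e_1,C_1,\dots,e_t,C_t)$ of configurations and transitions, where $C_0$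 is the initial configuration on $w$ and $e_i$ leads from $C_{i-1}$ to $C_i$; its length is $t$, its value is $\sigma(\gamma)=\sigma(e_1)\cdots\sigma(e_t)$, and it is accepting if the state of $C_t$ is in $F$. The machine is halting if it has only finitely many computations on each word. The behaviour of a halting machine is the series that maps $w$ to $\sum_\gamma\sigma(\gamma)$, the sum being over all accepting computations $\gamma$ on $w$; its running time $\mathsf{TIME}(\mathcal M,n)$ is the maximal length of a computation on a word of length at most $n$. The class $\mathbf{NP}[S]$ consists of all series, over all alphabets $\Sigma$, that are the behaviour of a halting weighted Turing machine $\mathcal M$ over $S$ and $\Sigma$ with $\mathsf{TIME}(\mathcal M,n)=O(n^k)$ for some $k\in\mathbb N$. **$\mathbf{FP}[S]$.** For a finite set $G\subseteq S$, let $T(G)$ be the set of terms, i.e. the least set of words over $G\cup\{0,1,+,\cdot,(,)\}$ that contains $G\cup\{0,1\}$ and with $t_1,t_2$ also $(t_1+t_2)$ and $(t_1\cdot t_2)$. Each term $t$ evaluates to an element $h_G[S](t)$ of the subsemiring $\langle G\rangle$ of $S$ generated by $G$. The class $\mathbf{FP}[S]$ consists of all $f\colon\Sigma^*\to S$, over all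 alphabets $\Sigma$, for which there are a finite set $G\subseteq S$ with $f(\Sigma^*)\subseteq\langle G\rangle$ and a deterministic multitape Turing machine with output that, in a number of steps polynomial in $|w|$, transforms each input $w\in\Sigma^*$ to some term $t(w)\in T(G)$ with $h_G[S](t(w))=f(w)$. -/

import Mathlib

universe u v

namespace WeightedComplexity

/-! ## Alphabets and formal power series -/

/-- An alphabet is a finite nonempty type of letters. -/
structure Alphabet : Type (v + 1) where
  carrier : Type v
  finite : Finite carrier
  nonempty : Nonempty carrier

instance : CoeSort Alphabet.{v} (Type v) := ⟨Alphabet.carrier⟩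

/-- A formal power series over `S`: an alphabet `A` together with a map `A* → S`. -/
abbrev Series (S : Type u) : Type (max u (v + 1)) := (A : Alphabet.{v}) × (List A → S)

/-- The content of a two-way infinite tape holding the word `w` in the cells
`0, …, |w| - 1`, all other cells being blank. -/
def wordTape {A Γ : Type*} (blank : Γ) (letter : A → Γ) (w : List A) : ℤ → Γ :=
  fun i => if 0 ≤ i then (w.map letter).getD i.toNat blank else blank

/-! ## Weighted Turing machines -/

/-- A transition: in state `source` reading `read`, change the state to `target`, write `write`
and move the head by `move ∈ {-1, 0, 1}` cells to the right. -/
structure Transition (Q Γ : Type) where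
  source : Q
  read : Γ
  target : Q
  write : Γ
  move : SignType

/-- A (single-tape) weighted Turing machine over the semiring `S` with input alphabet `A`. -/
structure WTM (S : Type u) [Semiring S] (A : Type v) where
  Q : Type
  Γ : Type
  finite_Q : Finite Q
  finite_Γ : Finite Γ
  /-- The inclusion of the input alphabet in the working alphabet. -/
  letter : A ↪ Γ
  blank : Γ
  letter_ne_blank : ∀ a, letter a ≠ blank
  start : Q
  /-- The set of accepting states. -/
  F : Set Q
  Δ : Set (Transition Q Γ)
  source_notMem : ∀ e ∈ Δ, e.source ∉ F
  write_ne_blank : ∀ e ∈ Δ, e.write ≠ blank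
  weight : Δ → S
  weight_ne_zero : ∀ e, weight e ≠ 0

namespace WTM

variable {S : Type u} [Semiring S] {A : Type v} (M : WTM S A)

/-- A configuration: the state, the tape content and the head position. -/
structure Cfg where
  state : M.Q
  tape : ℤ → M.Γ
  head : ℤ

/-- The initial configuration on the input word `w`. -/
def init (w : List A) : M.Cfg := ⟨M.start, wordTape M.blank M.letter w, 0⟩

/-- `C₁ →ₑ C₂`. -/
def Step (C₁ : M.Cfg) (e : M.Δ) (C₂ : M.Cfg) : Prop :=
  C₁.state = e.1.source ∧ C₁.tape C₁.head = e.1.read ∧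
    C₂ = ⟨e.1.target, Function.update C₁.tape C₁.head e.1.write, C₁.head + (e.1.move : ℤ)⟩

/-- `M.IsRun C₀ [(e₁, C₁), …, (eₜ, Cₜ)]` says that `C₀ →_{e₁} C₁ →_{e₂} ⋯ →_{eₜ} Cₜ`. -/
def IsRun : M.Cfg → List (M.Δ × M.Cfg) → Prop
  | _, [] => True
  | C, (e, C') :: γ => M.Step C e C' ∧ IsRun C' γ

/-- The set of computations on `w`; the computation `(C₀, e₁, C₁, …, eₜ, Cₜ)`, in which `C₀` is
necessarily `M.init w`, is represented by the list `[(e₁, C₁), …, (eₜ, Cₜ)]`. -/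
def computations (w : List A) : Set (List (M.Δ × M.Cfg)) := {γ | M.IsRun (M.init w) γ}

/-- The last configuration of a computation starting in `C`. -/
def lastCfg : M.Cfg → List (M.Δ × M.Cfg) → M.Cfg
  | C, [] => C
  | _, (_, C') :: γ => lastCfg C' γ

/-- The set of accepting computations on `w`. -/
def accepting (w : List A) : Set (List (M.Δ × M.Cfg)) :=
  {γ | γ ∈ M.computations w ∧ (M.lastCfg (M.init w) γ).state ∈ M.F}

/-- The value of a computation: the product of its transition weights, in order. -/
def value (γ : List (M.Δ × M.Cfg)) : S := (γ.map fun p => M.weight p.1).prod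

/-- There are only finitely many computations on each input word. -/
def Halting : Prop := ∀ w, (M.computations w).Finite

/-- The behaviour of the machine (meaningful for halting machines, where the sum is finite). -/
noncomputable def behaviour (w : List A) : S := ∑ᶠ γ ∈ M.accepting w, M.value γ

/-- The maximal length of a computation on `w` (for halting machines). -/
noncomputable def timeOn (w : List A) : ℕ := sSup (List.length '' M.computations w)

/-- The maximal length of a computation on a word of length at most `n`. -/
noncomputable def time (n : ℕ) : ℕ := sSup (M.timeOn '' {w | w.length ≤ n})

end WTM

/-- The series over `S` realised by halting single-tape weighted Turing machines running in time
`O(f(n))`. -/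
def NTIME1 (S : Type u) [Semiring S] (f : ℕ → ℕ) : Set (Series.{u, v} S) :=
  {r | ∃ M : WTM S r.1, M.Halting ∧ M.behaviour = r.2 ∧
    Asymptotics.IsBigO Filter.atTop (fun n => (M.time n : ℝ)) (fun n => (f n : ℝ))}

/-- The class `NP[S]`. -/
def NP (S : Type u) [Semiring S] : Set (Series.{u, v} S) :=
  ⋃ k : ℕ, NTIME1 S (fun n => n ^ k)

/-! ## Terms over generators, as words -/

/-- The symbols `g ∈ G`, `0`, `1`, `+`, `·`, `(`, `)` in which terms are written. -/
inductive Token (G : Type u) : Type u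
  | gen (g : G)
  | zero
  | one
  | add
  | mul
  | lpar
  | rpar

/-- Terms of type `(2, 2, 0, 0)` over the generators `G`. -/
inductive SemiringTerm (G : Type u) : Type u
  | gen (g : G)
  | zero
  | one
  | add (s t : SemiringTerm G)
  | mul (s t : SemiringTerm G)

namespace SemiringTerm

/-- The term as a word: constants are single letters, and compound terms are written
`(t₁ + t₂)` and `(t₁ · t₂)`. -/
def word {G : Type u} : SemiringTerm G → List (Token G)
  | gen g => [.gen g]
  | zero => [.zero]
  | one => [.one]
  | add s t => [.lpar] ++ word s ++ [.add] ++ word t ++ [.rpar]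
  | mul s t => [.lpar] ++ word s ++ [.mul] ++ word t ++ [.rpar]

/-- The evaluation homomorphism, for generators in a finite subset `G` of `S`. -/
def eval {S : Type u} [Semiring S] {G : Finset S} : SemiringTerm G → S
  | gen g => g
  | zero => 0
  | one => 1
  | add s t => eval s + eval t
  | mul s t => eval s * eval t

end SemiringTerm

/-! ## Deterministic multitape Turing machines with output -/

/-- A deterministic Turing machine with `k + 2` two-way infinite tapes, with input alphabet `A` and
output alphabet `B`. Tape `0` is the input tape, the last tape is the output tape. The transition
function is partial, and the machine halts when no transition applies. -/
structure DTM (A : Type v) (B : Type u) where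
  k : ℕ
  Q : Type
  Γ : Type
  finite_Q : Finite Q
  finite_Γ : Finite Γ
  inLetter : A ↪ Γ
  outLetter : B ↪ Γ
  blank : Γ
  inLetter_ne_blank : ∀ a, inLetter a ≠ blank
  outLetter_ne_blank : ∀ b, outLetter b ≠ blank
  start : Q
  /-- The new state, and for each tape the symbol to be written and the head movement. -/
  δ : Q → (Fin (k + 2) → Γ) → Option (Q × (Fin (k + 2) → Γ) × (Fin (k + 2) → SignType))

namespace DTM

variable {A : Type v} {B : Type u} (M : DTM A B)

/-- A configuration: the state, the contents of the tapes and the head positions. -/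
structure Cfg where
  state : M.Q
  tape : Fin (M.k + 2) → ℤ → M.Γ
  head : Fin (M.k + 2) → ℤ

/-- The initial configuration: `w` on the input tape, all other tapes blank. -/
def init (w : List A) : M.Cfg where
  state := M.start
  tape := fun i => if i = 0 then wordTape M.blank M.inLetter w else fun _ => M.blank
  head := fun _ => 0

/-- One computation step; `none` if the machine has halted. -/
def step (C : M.Cfg) : Option M.Cfg :=
  (M.δ C.state fun i => C.tape i (C.head i)).map fun a =>
    { state := a.1
      tape := fun i => Function.update (C.tape i) (C.head i) (a.2.1 i)
      head := fun i => C.head i + (a.2.2 i : ℤ) }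

/-- On input `w`, the machine halts after exactly `t` steps with `x` on its output tape. -/
def OutputsIn (w : List A) (x : List B) (t : ℕ) : Prop :=
  ∃ C : M.Cfg, (fun o => o.bind M.step)^[t] (some (M.init w)) = some C ∧ M.step C = none ∧
    C.tape (Fin.last (M.k + 1)) = wordTape M.blank M.outLetter x

end DTM

/-- The class `FP_G[S]`: the functions `f : A* → ⟨G⟩`, over all alphabets `A`, for which some
deterministic polynomial-time machine transforms each `w` into a term over `G` that evaluates to
`f(w)`. -/
def FPGen (S : Type u) [Semiring S] (G : Finset S) : Set (Series.{u, v} S) :=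
  {f | (∀ w, f.2 w ∈ Subsemiring.closure (G : Set S)) ∧
    ∃ (M : DTM f.1 (Token G)) (p : Polynomial ℕ), ∀ w : List f.1,
      ∃ (t : SemiringTerm G) (n : ℕ),
        n ≤ p.eval w.length ∧ M.OutputsIn w t.word n ∧ t.eval = f.2 w}

/-- The class `FP[S]`. -/
def FP (S : Type u) [Semiring S] : Set (Series.{u, v} S) :=
  ⋃ G : Finset S, FPGen S G

end WeightedComplexity

namespace WeightedComplexity

/-! A weighted machine can run the given deterministic machine with all weights 1 and then evaluate
the term on the output tape by guessing. Distributivity expands a term into a sum of products of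
constants, and the machine has one accepting computation for each summand without a zero factor. At
an opening bracket it guesses which operands to evaluate: left, right or both. The guess is stored
in place of the bracket and checked at the operator: "left" and "right" survive at `+`, "both"
survives at `·`, and a wrong guess gets stuck and contributes 0. An operand that is not evaluated is
skipped with weight 1. Operands are read from left to right, so noncommutative products come out in
the right order. Processed cells are marked as done; hence the nearest other cell to the left is the
enclosing bracket, and no stack is needed.

`Yields` records finiteness, a length bound and total weight together, and is propagated backwards
along transitions by `yields_of_successors`. Evaluation is an induction on terms (`processes_skip`,
`processes_eval`). For the simulation, the tapes become tracks of one tape and are shifted so that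
all heads stay at cell 0 (`ryields_step`, `ryields_run`). The visited interval grows by a constant
per simulated step and evaluation takes quadratic time, so the total time is polynomial. -/

theorem finite_transition (Q Γ : Type) [Finite Q] [Finite Γ] : Finite (Transition Q Γ) :=
  Finite.of_injective
    (fun e : Transition Q Γ => (e.source, e.read, e.target, e.write, e.move)) <| by
    rintro ⟨⟩ ⟨⟩ h
    simpa using h

namespace WTM

/-! ### Total weight of the runs from a configuration -/

section Runs

variable {S : Type u} [Semiring S] {A : Type v} (M : WTM S A)

/-- The accepting runs starting in `C`. -/
def acceptingRuns (C : M.Cfg) : Set (List (M.Δ × M.Cfg)) :=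
  {γ | M.IsRun C γ ∧ (M.lastCfg C γ).state ∈ M.F}

/-- There are finitely many runs from `C`, none is longer than `n`, and the accepting ones
have total value `s`. -/
structure Yields (C : M.Cfg) (s : S) (n : ℕ) : Prop where
  finite : {γ | M.IsRun C γ}.Finite
  length_le : ∀ γ, M.IsRun C γ → γ.length ≤ n
  value_eq : ∑ᶠ γ ∈ M.acceptingRuns C, M.value γ = s

variable {M}

theorem Yields.mono {C : M.Cfg} {s : S} {m n : ℕ} (h : M.Yields C s m) (hmn : m ≤ n) :
    M.Yields C s n :=
  ⟨h.finite, fun γ hγ => (h.length_le γ hγ).trans hmn, h.value_eq⟩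

/-- The one-step runs from `C`. -/
def successors (C : M.Cfg) : Set (M.Δ × M.Cfg) := {p | M.Step C p.1 p.2}

theorem finite_successors (C : M.Cfg) : (successors C).Finite := by
  have := M.finite_Q
  have := M.finite_Γ
  have := finite_transition M.Q M.Γ
  refine Set.Finite.of_injOn (f := Prod.fst) (t := Set.univ) (fun _ _ => trivial) ?_
    Set.finite_univ
  rintro ⟨e, C₁⟩ h₁ ⟨e', C₂⟩ h₂ h
  obtain rfl : e = e' := h
  exact Prod.ext rfl (h₁.2.2.trans h₂.2.2.symm)

theorem isRun_eq (C : M.Cfg) : {γ | M.IsRun C γ} =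
    insert [] (⋃ p ∈ successors C, List.cons p '' {γ | M.IsRun p.2 γ}) := by
  ext γ
  rcases γ with _ | ⟨⟨e, C'⟩, γ⟩
  · simp [IsRun]
  · simp [IsRun, successors, and_comm]

theorem acceptingRuns_eq {C : M.Cfg} (hC : C.state ∉ M.F) : M.acceptingRuns C =
    ⋃ p ∈ successors C, List.cons p '' M.acceptingRuns p.2 := by
  ext γ
  rcases γ with _ | ⟨⟨e, C'⟩, γ⟩
  · simp [acceptingRuns, lastCfg, hC]
  · simpa [acceptingRuns, IsRun, lastCfg, successors] using by tauto

theorem Yields.finite_acceptingRuns {C : M.Cfg} {s : S} {n : ℕ} (h : M.Yields C s n) :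
    (M.acceptingRuns C).Finite :=
  h.finite.subset fun _ hγ => hγ.1

theorem yields_of_mem_F {C : M.Cfg} (hC : C.state ∈ M.F) : M.Yields C 1 0 := by
  have hs : successors C = ∅ := by
    refine Set.eq_empty_of_forall_notMem fun p hp => M.source_notMem p.1.1 p.1.2 ?_
    rw [← hp.1]
    exact hC
  have hr : {γ | M.IsRun C γ} = {[]} := by rw [isRun_eq, hs]; simp
  have ha : M.acceptingRuns C = {[]} := by
    refine Set.Subset.antisymm (fun γ hγ => hr ▸ hγ.1) ?_
    rintro _ rfl
    exact ⟨trivial, hC⟩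
  refine ⟨hr ▸ Set.finite_singleton _, fun γ hγ => ?_, ?_⟩
  · have : γ ∈ ({[]} : Set (List (M.Δ × M.Cfg))) := hr ▸ hγ
    simp [Set.mem_singleton_iff.1 this]
  · simp [ha, value]

/-- Nonempty runs are classified by their first transition, whose weight factors out on the left;
the empty run is not accepting. -/
theorem yields_of_successors {C : M.Cfg} {n : ℕ} (hC : C.state ∉ M.F) (f : M.Δ × M.Cfg → S)
    (h : ∀ p ∈ successors C, M.Yields p.2 (f p) n) :
    M.Yields C (∑ᶠ p ∈ successors C, M.weight p.1 * f p) (n + 1) := by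
  refine ⟨?_, fun γ hγ => ?_, ?_⟩
  · rw [isRun_eq]
    exact ((finite_successors C).biUnion fun p hp => (h p hp).finite.image _).insert _
  · rcases γ with _ | ⟨⟨e, C'⟩, γ⟩
    · simp
    · simpa using (h (e, C') hγ.1).length_le γ hγ.2
  · rw [acceptingRuns_eq hC, finsum_mem_biUnion]
    · refine finsum_mem_congr rfl fun p hp => ?_
      rw [finsum_mem_image (List.cons_injective.injOn), ← (h p hp).value_eq,
        mul_finsum_mem' _ _ (h p hp).finite_acceptingRuns]
      rfl
    · intro p _ q _ hpq
      refine Set.disjoint_left.2 ?_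
      rintro _ ⟨γ, _, rfl⟩ ⟨γ', _, h'⟩
      exact hpq (List.cons.inj h').1.symm
    · exact finite_successors C
    · exact fun p hp => (h p hp).finite_acceptingRuns.image _

end Runs

/-! ### Machines given by a finite table -/

section Table

variable {S : Type u} [Semiring S] {A : Type v} {Q Γ : Type} [Finite Q] [Finite Γ]

/-- The machine given by a table `tr` of successor states, symbols and moves, in which the weight
of a transition is determined by its source state and the symbol read. -/
def ofTable (letter : A ↪ Γ) (blank : Γ) (hblank : ∀ a, letter a ≠ blank) (start acc : Q)
    (tr : Q → Γ → List (Q × Γ × SignType)) (wt : Q → Γ → S) : WTM S A where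
  Q := Q
  Γ := Γ
  finite_Q := inferInstance
  finite_Γ := inferInstance
  letter := letter
  blank := blank
  letter_ne_blank := hblank
  start := start
  F := {acc}
  Δ := {e | (e.target, e.write, e.move) ∈ tr e.source e.read ∧ e.source ≠ acc ∧
    e.write ≠ blank ∧ wt e.source e.read ≠ 0}
  source_notMem := fun _ he => he.2.1
  write_ne_blank := fun _ he => he.2.2.1
  weight := fun e => wt e.1.source e.1.read
  weight_ne_zero := fun e => e.2.2.2.2

variable {letter : A ↪ Γ} {blank : Γ} {hblank : ∀ a, letter a ≠ blank} {start acc : Q}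
  {tr : Q → Γ → List (Q × Γ × SignType)} {wt : Q → Γ → S}

/-- Transitions form a set, so a repeated table entry would count only once; hence the list must
have no duplicates. -/
theorem ofTable_yields (q : Q) (T : ℤ → Γ) (h : ℤ) {n : ℕ} (f : Q × Γ × SignType → S)
    (hq : q ≠ acc) (hnodup : (tr q (T h)).Nodup) (hne : ∀ x ∈ tr q (T h), x.2.1 ≠ blank)
    (hf : ∀ x ∈ tr q (T h), (ofTable letter blank hblank start acc tr wt).Yields
      ⟨x.1, Function.update T h x.2.1, h + (x.2.2 : ℤ)⟩ (f x) n) :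
    (ofTable letter blank hblank start acc tr wt).Yields ⟨q, T, h⟩
      (wt q (T h) * ((tr q (T h)).map f).sum) (n + 1) := by
  set M := ofTable letter blank hblank start acc tr wt with hM
  set C : M.Cfg := ⟨q, T, h⟩ with hC
  let out : M.Δ × M.Cfg → Q × Γ × SignType := fun p => (p.1.1.target, p.1.1.write, p.1.1.move)
  have hout : ∀ p ∈ successors C, out p ∈ tr q (T h) ∧ wt q (T h) ≠ 0 ∧
      M.weight p.1 = wt q (T h) ∧
      p.2 = ⟨(out p).1, Function.update T h (out p).2.1, h + ((out p).2.2 : ℤ)⟩ := by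
    rintro ⟨⟨⟨q₁, c, q', d, m⟩, he⟩, C'⟩ ⟨h₁, h₂, h₃⟩
    obtain rfl : q = q₁ := h₁
    obtain rfl : T h = c := h₂
    exact ⟨he.1, he.2.2.2, rfl, h₃⟩
  have key := yields_of_successors (M := M) (C := C) (n := n) (fun h' => hq h')
    (fun p => f (out p)) fun p hp => by
      obtain ⟨h₁, -, -, h₂⟩ := hout p hp
      rw [h₂]
      exact hf _ h₁
  convert key using 1
  -- Transitions of weight 0 are absent from the machine, which agrees with the factor 0 on the
  -- left.
  by_cases hw : wt q (T h) = 0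
  · have : successors C = ∅ :=
      Set.eq_empty_of_forall_notMem fun p hp => (hout p hp).2.1 hw
    simp [hw, this]
  · classical
    rw [← List.sum_toFinset _ hnodup, Finset.mul_sum, ← finsum_mem_coe_finset]
    refine (finsum_mem_eq_of_bijOn out ⟨fun p hp => ?_, ?_, ?_⟩ ?_).symm
    · simpa using (hout p hp).1
    · rintro p hp p' hp' hpp
      obtain ⟨-, -, -, h₂⟩ := hout p hp
      obtain ⟨-, -, -, h₂'⟩ := hout p' hp'
      refine Prod.ext (Subtype.ext ?_) (by rw [h₂, h₂', hpp])
      obtain ⟨⟨⟨q₁, c, q', d, m⟩, he⟩, C'⟩ := p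
      obtain ⟨⟨⟨q₁', c', q'', d', m'⟩, he'⟩, C''⟩ := p'
      have e₁ := hp.1.symm.trans hp'.1
      have e₂ := hp.2.1.symm.trans hp'.2.1
      obtain ⟨a₁, a₂⟩ := Prod.mk.inj hpp
      obtain ⟨a₂, a₃⟩ := Prod.mk.inj a₂
      simp only at e₁ e₂ a₁ a₂ a₃
      simp [e₁, e₂, a₁, a₂, a₃]
    · intro x hx
      have hx : x ∈ tr q (T h) := by simpa using hx
      exact ⟨(⟨⟨q, T h, x.1, x.2.1, x.2.2⟩, hx, hq, hne x hx, hw⟩,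
        ⟨x.1, Function.update T h x.2.1, h + (x.2.2 : ℤ)⟩), ⟨rfl, rfl, rfl⟩, rfl⟩
    · intro p hp
      rw [(hout p hp).2.2.1]

theorem ofTable_yields_one {q : Q} {T : ℤ → Γ} {h : ℤ} {n : ℕ} {s : S} {q' : Q} {d : Γ}
    {m : SignType} (hq : q ≠ acc) (htr : tr q (T h) = [(q', d, m)]) (hd : d ≠ blank)
    (hy : (ofTable letter blank hblank start acc tr wt).Yields
      ⟨q', Function.update T h d, h + (m : ℤ)⟩ s n) :
    (ofTable letter blank hblank start acc tr wt).Yields ⟨q, T, h⟩ (wt q (T h) * s) (n + 1) := by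
  have := ofTable_yields (hblank := hblank) (start := start) (tr := tr) (wt := wt) q T h (n := n)
    (fun _ => s) hq (by simp [htr]) (by simpa [htr] using hd) (by simpa [htr] using hy)
  simpa [htr] using this

theorem ofTable_yields_none {q : Q} {T : ℤ → Γ} {h : ℤ} (hq : q ≠ acc)
    (htr : tr q (T h) = []) :
    (ofTable letter blank hblank start acc tr wt).Yields ⟨q, T, h⟩ 0 1 := by
  have := ofTable_yields (hblank := hblank) (start := start) (tr := tr) (wt := wt) q T h (n := 0)
    (fun _ => 0) hq (by simp [htr]) (by simp [htr]) (by simp [htr])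
  simpa [htr] using this

end Table

end WTM

/-! ### Alphabet and states of the simulating machine -/

namespace Simulation

/-- Marks carried by a tape cell: `plain` and `center` (the common head position) for cells of
the simulated tapes; the other marks replace the symbols of a term during its evaluation. -/
inductive Mark : Type
  | plain
  | center
  | left
  | right
  | both
  | skip
  | done

/-- The working alphabet; a `cell` holds one symbol of each of the simulated tapes. -/
inductive Sym (k : ℕ) (Γ : Type) : Type
  | blank
  | raw (g : Γ)
  | cell (f : Mark) (v : Fin (k + 2) → Γ)

/-- Whether the subterm to be read next is to be evaluated or to be skipped, or whether a subterm
has just been completed. -/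
inductive Mode : Type
  | eval
  | skip
  | next

/-- The symbol because of which the machine returns to the last opening bracket. -/
inductive Cause : Type
  | add
  | mul
  | close

inductive State (k : ℕ) (Q Γ : Type) : Type
  | init
  | sim (q : Q)
  | toLeft (r : Option (Q × (Fin (k + 2) → SignType)))
  | sweepRight (q : Q) (m : Fin (k + 2) → SignType) (u : Fin (k + 2) → Γ)
  | sweepLeft (q : Q) (m : Fin (k + 2) → SignType) (u : Fin (k + 2) → Γ)
  | term (m : Mode)
  | back (o : Cause)
  | acc

instance : Finite Mark :=
  Finite.of_injective (β := Fin 7) (fun f => match f with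
    | .plain => 0 | .center => 1 | .left => 2 | .right => 3 | .both => 4 | .skip => 5
    | .done => 6) <| by
    rintro (_ | _) (_ | _) <;> simp

instance : Finite Mode :=
  Finite.of_injective (β := Fin 3) (fun f => match f with
    | .eval => 0 | .skip => 1 | .next => 2) <| by
    rintro (_ | _) (_ | _) <;> simp

instance : Finite Cause :=
  Finite.of_injective (β := Fin 3) (fun f => match f with
    | .add => 0 | .mul => 1 | .close => 2) <| by
    rintro (_ | _) (_ | _) <;> simp

instance (k : ℕ) (Γ : Type) [Finite Γ] : Finite (Sym k Γ) :=
  Finite.of_injective (β := Option (Γ ⊕ (Mark × (Fin (k + 2) → Γ)))) (fun f => match f with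
    | .blank => none | .raw g => some (.inl g) | .cell f v => some (.inr (f, v))) <| by
    rintro (_ | _) (_ | _) <;> simp

instance (k : ℕ) (Q Γ : Type) [Finite Q] [Finite Γ] : Finite (State k Q Γ) :=
  Finite.of_injective (β := Bool ⊕ Bool × (Q × (Fin (k + 2) → SignType) × (Fin (k + 2) → Γ)) ⊕
      Q ⊕ Option (Q × (Fin (k + 2) → SignType)) ⊕ Mode ⊕ Cause)
    (fun f => match f with
    | .init => .inl true
    | .acc => .inl false
    | .sweepRight q m u => .inr (.inl (true, q, m, u))
    | .sweepLeft q m u => .inr (.inl (false, q, m, u))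
    | .sim q => .inr (.inr (.inl q))
    | .toLeft r => .inr (.inr (.inr (.inl r)))
    | .term m => .inr (.inr (.inr (.inr (.inl m))))
    | .back o => .inr (.inr (.inr (.inr (.inr o))))) <| by
    rintro (_ | _) (_ | _) <;> simp

/-! ### Transition table of the simulating machine -/

section Table

variable {G : Type u} {A : Type v} (M : DTM A (Token G))

/-- The mark of a cell and the vector of symbols which it represents. -/
def view : Sym M.k M.Γ → Mark × (Fin (M.k + 2) → M.Γ)
  | .blank => (.plain, fun _ => M.blank)
  | .raw g => (.plain, fun i => if i = 0 then g else M.blank)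
  | .cell f v => (f, v)

/-- The blank may not be written, so even an unchanged cell turns into a `cell`. Thus `Sym.blank`
identifies the cells outside the used interval. -/
def keep (c : Sym M.k M.Γ) : Sym M.k M.Γ := .cell (view M c).1 (view M c).2

@[simp] theorem view_keep (c : Sym M.k M.Γ) : view M (keep M c) = view M c := rfl

/-- All tracks are erased, so a marked cell carries no token and is passed over later. -/
def mark (f : Mark) : Sym M.k M.Γ := .cell f fun _ => M.blank

@[simp] theorem keep_mark (f : Mark) : keep M (mark M f) = mark M f := rfl

@[simp] theorem view_mark (f : Mark) : view M (mark M f) = (f, fun _ => M.blank) := rfl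

/-- The token that the output tape has in a cell. -/
noncomputable def token (c : Sym M.k M.Γ) : Option (Token G) :=
  Function.partialInv M.outLetter ((view M c).2 (Fin.last (M.k + 1)))

theorem partialInv_outLetter_blank : Function.partialInv M.outLetter M.blank = none := by
  by_contra h
  obtain ⟨b, hb⟩ := Option.ne_none_iff_exists'.1 h
  exact M.outLetter_ne_blank b
    ((M.outLetter.injective.isPartialInv b M.blank).1 hb)

@[simp] theorem token_mark (f : Mark) : token M (mark M f) = none :=
  partialInv_outLetter_blank M

theorem token_eq_some {c : Sym M.k M.Γ} {b : Token G}
    (h : (view M c).2 (Fin.last (M.k + 1)) = M.outLetter b) : token M c = some b := by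
  rw [token, h]
  exact Function.partialInv_left M.outLetter.injective b

theorem token_eq_none {c : Sym M.k M.Γ}
    (h : (view M c).2 (Fin.last (M.k + 1)) = M.blank) : token M c = none := by
  rw [token, h, partialInv_outLetter_blank]

/-- The replacement for a mark, and the mode in which to go on, upon a return to the mark;
`none` if the guess recorded by the mark turns out to be wrong. -/
def resume : Cause → Mark → Option (Mark × Mode)
  | .add, .left => some (.left, .skip)
  | .add, .right => some (.right, .eval)
  | .add, .skip => some (.skip, .skip)
  | .mul, .both => some (.both, .eval)
  | .mul, .skip => some (.skip, .skip)
  | .close, _ => some (.done, .next)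
  | _, _ => none

abbrev Action : Type := State M.k M.Q M.Γ × Sym M.k M.Γ × SignType

/-- The three actions at a bracket are the guesses. The constant 0 has no action: its value is the
empty sum. -/
noncomputable def evalTable (c : Sym M.k M.Γ) : Option (Token G) → List (Action M)
  | none => [(.term .eval, keep M c, 1)]
  | some .lpar => [(.term .eval, mark M .left, 1), (.term .skip, mark M .right, 1),
      (.term .eval, mark M .both, 1)]
  | some (.gen _) => [(.term .next, mark M .done, 1)]
  | some .one => [(.term .next, mark M .done, 1)]
  | some _ => []

/-- Nothing is guessed here, and every constant is passed, 0 included: a skipped operand must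
contribute the factor 1. -/
noncomputable def skipTable (c : Sym M.k M.Γ) : Option (Token G) → List (Action M)
  | none => [(.term .skip, keep M c, 1)]
  | some .lpar => [(.term .skip, mark M .skip, 1)]
  | some _ => [(.term .next, mark M .done, 1)]

open Classical in
noncomputable def nextTable (c : Sym M.k M.Γ) : Option (Token G) → List (Action M)
  | none => if (view M c).1 = .done then [(.term .next, keep M c, 1)] else [(.acc, keep M c, 1)]
  | some .add => [(.back .add, mark M .done, -1)]
  | some .mul => [(.back .mul, mark M .done, -1)]
  | some .rpar => [(.back .close, mark M .done, -1)]
  | some _ => []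

/-- The state in which to go on after reaching the left end of the tape. -/
def afterLeft : Option (M.Q × (Fin (M.k + 2) → SignType)) → State M.k M.Q M.Γ
  | none => .term .eval
  | some (q, m) => .sweepRight q m fun _ => M.blank

open Classical in
/-- The actions of the simulating machine. -/
noncomputable def table : State M.k M.Q M.Γ → Sym M.k M.Γ → List (Action M)
  | .init, c => [(.sim M.start, .cell .center (view M c).2, 0)]
  | .sim q, c =>
    if (view M c).1 = .center then
      match M.δ q (view M c).2 with
      | none => [(.toLeft none, keep M c, -1)]
      | some (q', v, m) => [(.toLeft (some (q', m)), .cell .center v, -1)]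
    else [(.sim q, keep M c, 1)]
  | .toLeft r, c =>
    if c = .blank then
      [(afterLeft M r, keep M c, 0)]
    else [(.toLeft r, keep M c, -1)]
  | .sweepRight q m u, c =>
    if c = .blank then
      [(.sweepLeft q m fun _ => M.blank,
        .cell (view M c).1 fun i => if m i = -1 then u i else (view M c).2 i, 0)]
    -- The state carries the old vector of the cell being left, which its neighbour needs after that
    -- cell has been overwritten.
    else [(.sweepRight q m (view M c).2,
        .cell (view M c).1 fun i => if m i = -1 then u i else (view M c).2 i, 1)]
  | .sweepLeft q m u, c =>
    if c = .blank then
      [(.sim q, .cell (view M c).1 fun i => if m i = 1 then u i else (view M c).2 i, 0)]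
    else [(.sweepLeft q m (view M c).2,
        .cell (view M c).1 fun i => if m i = 1 then u i else (view M c).2 i, -1)]
  | .term .eval, c => evalTable M c (token M c)
  | .term .skip, c => skipTable M c (token M c)
  | .term .next, c => nextTable M c (token M c)
  | .back o, c =>
    if (view M c).1 = .done then [(.back o, keep M c, -1)]
    else match resume o (view M c).1 with
      | none => []
      | some (f, m) => [(.term m, mark M f, 1)]
  | .acc, _ => []

end Table

/-! ### The weighted machine and its single steps -/

section Machine

variable {S : Type u} [Semiring S] {G : Finset S} {A : Type v} (M : DTM A (Token G))

noncomputable def wt : State M.k M.Q M.Γ → Sym M.k M.Γ → S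
  | .term .eval, c => match token M c with
    | some (.gen g) => g
    | _ => 1
  | _, _ => 1

/-- The weighted machine which simulates `M` and then evaluates the term on the output tape. -/
noncomputable def machine : WTM S A :=
  haveI := M.finite_Q
  haveI := M.finite_Γ
  WTM.ofTable (Q := State M.k M.Q M.Γ) (Γ := Sym M.k M.Γ)
    ⟨fun a => .raw (M.inLetter a), fun _ _ h => M.inLetter.injective (Sym.raw.inj h)⟩
    .blank (fun _ => nofun) .init .acc (table M) (wt M)

/-- `WTM.Yields` for the simulating machine. -/
def Yields (q : State M.k M.Q M.Γ) (T : ℤ → Sym M.k M.Γ) (h : ℤ) (s : S) (n : ℕ) : Prop :=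
  (machine M).Yields ⟨q, T, h⟩ s n

variable {M}

theorem Yields.mono {q : State M.k M.Q M.Γ} {T : ℤ → Sym M.k M.Γ} {h : ℤ} {s : S} {m n : ℕ}
    (hy : Yields M q T h s m) (hmn : m ≤ n) : Yields M q T h s n :=
  WTM.Yields.mono hy hmn

theorem yields_acc (T : ℤ → Sym M.k M.Γ) (h : ℤ) : Yields M .acc T h 1 0 :=
  WTM.yields_of_mem_F (M := machine M) (C := ⟨.acc, T, h⟩) rfl

theorem yields_none {q : State M.k M.Q M.Γ} {T : ℤ → Sym M.k M.Γ} {h : ℤ} (hq : q ≠ .acc)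
    (htr : table M q (T h) = []) : Yields M q T h 0 1 := by
  have := M.finite_Q
  have := M.finite_Γ
  exact WTM.ofTable_yields_none hq htr

theorem yields_weighted {q : State M.k M.Q M.Γ} {T : ℤ → Sym M.k M.Γ} {h : ℤ} {n : ℕ} {s : S}
    {q' : State M.k M.Q M.Γ} {d : Sym M.k M.Γ} {m : SignType} (hq : q ≠ .acc)
    (htr : table M q (T h) = [(q', d, m)]) (hd : d ≠ .blank)
    (hy : Yields M q' (Function.update T h d) (h + (m : ℤ)) s n) :
    Yields M q T h (wt M q (T h) * s) (n + 1) := by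
  have := M.finite_Q
  have := M.finite_Γ
  exact WTM.ofTable_yields_one hq htr hd hy

theorem yields_one {q : State M.k M.Q M.Γ} {T : ℤ → Sym M.k M.Γ} {h : ℤ} {n : ℕ} {s : S}
    {q' : State M.k M.Q M.Γ} {d : Sym M.k M.Γ} {m : SignType} (hq : q ≠ .acc)
    (htr : table M q (T h) = [(q', d, m)]) (hd : d ≠ .blank) (hw : wt M q (T h) = 1)
    (hy : Yields M q' (Function.update T h d) (h + (m : ℤ)) s n) :
    Yields M q T h s (n + 1) := by
  simpa [hw] using yields_weighted hq htr hd hy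

theorem yields_lpar {T : ℤ → Sym M.k M.Γ} {h : ℤ} {n : ℕ} {s₁ s₂ s₃ : S}
    (hc : token M (T h) = some .lpar)
    (h₁ : Yields M (.term .eval) (Function.update T h (mark M .left)) (h + 1) s₁ n)
    (h₂ : Yields M (.term .skip) (Function.update T h (mark M .right)) (h + 1) s₂ n)
    (h₃ : Yields M (.term .eval) (Function.update T h (mark M .both)) (h + 1) s₃ n) :
    Yields M (.term .eval) T h (s₁ + s₂ + s₃) (n + 1) := by
  have := M.finite_Q
  have := M.finite_Γ
  have htr : table M (.term .eval) (T h) = [(.term .eval, mark M .left, 1),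
    (.term .skip, mark M .right, 1), (.term .eval, mark M .both, 1)] := by
    simp [table, hc, evalTable]
  have hw : wt M (.term .eval) (T h) = 1 := by simp [wt, hc]
  -- Two of the branches enter the same state; only the mark that they write tells them apart.
  let f : Action M → S := fun x => match (view M x.2.1).1 with
    | .left => s₁
    | .right => s₂
    | _ => s₃
  have key : Yields M (.term .eval) T h
      (wt M (.term .eval) (T h) * ((table M (.term .eval) (T h)).map f).sum) (n + 1) := by
    refine WTM.ofTable_yields _ T h f (by simp) ?_ ?_ ?_ <;> rw [htr]
    · simp [mark]
    · simp [mark]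
    · intro x hx
      simp only [List.mem_cons, List.not_mem_nil, or_false] at hx
      rcases hx with rfl | rfl | rfl
      exacts [h₁, h₂, h₃]
  rw [htr, hw] at key
  simpa [f, add_assoc] using key

end Machine

/-! ### Tapes split at the head -/

section Zipper

open Stream'

/-- The tape with `L` to the left of cell `h`, and `R` from cell `h` on. -/
def tapeOf {α : Type*} (h : ℤ) (L R : Stream' α) : ℤ → α :=
  fun j => if j < h then L.get (h - 1 - j).toNat else R.get (j - h).toNat

variable {α : Type*}

@[simp] theorem tapeOf_cons_self (h : ℤ) (L R : Stream' α) (c : α) :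
    tapeOf h L (cons c R) h = c := by
  simp [tapeOf]

theorem update_tapeOf_right (h : ℤ) (L R : Stream' α) (c d : α) :
    Function.update (tapeOf h L (cons c R)) h d = tapeOf (h + 1) (cons d L) R := by
  ext j
  rcases lt_trichotomy j h with hj | rfl | hj
  · obtain ⟨i, rfl⟩ : ∃ i : ℕ, j = h - 1 - i := ⟨(h - 1 - j).toNat, by omega⟩
    have h₂ : (h - (h - 1 - (i : ℤ))).toNat = i + 1 := by omega
    simp [tapeOf, hj, hj.trans (lt_add_one h), hj.ne, h₂]
  · simp [tapeOf]
  · obtain ⟨i, rfl⟩ : ∃ i : ℕ, j = h + 1 + i := ⟨(j - h - 1).toNat, by omega⟩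
    have h₁ : (h + 1 + (i : ℤ) - h).toNat = i + 1 := by omega
    simp [tapeOf, hj.ne', hj.not_gt, h₁, show ¬ h + 1 + (i : ℤ) ≤ h by omega]

theorem update_tapeOf_left (h : ℤ) (L R : Stream' α) (l c d : α) :
    Function.update (tapeOf h (cons l L) (cons c R)) h d =
      tapeOf (h - 1) L (cons l (cons d R)) := by
  have h₁ := update_tapeOf_right (h - 1) L (cons c R) l l
  have h₂ := update_tapeOf_right (h - 1) L (cons d R) l l
  rw [sub_add_cancel] at h₁ h₂
  rw [← h₁, ← Function.update_eq_self (h - 1) (tapeOf (h - 1) L (cons l (cons d R)))]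
  simp only [tapeOf_cons_self]
  rw [h₁, h₂]
  ext j
  rcases eq_or_ne j h with rfl | hj
  · simp [tapeOf]
  · rcases lt_or_ge j h with hj' | hj'
    · simp [tapeOf, hj, hj']
    · obtain ⟨i, rfl⟩ : ∃ i : ℕ, j = h + 1 + i := ⟨(j - h - 1).toNat, by omega⟩
      have h₁ : (h + 1 + (i : ℤ) - h).toNat = i + 1 := by omega
      simp [tapeOf, hj, hj'.not_gt, h₁]

theorem tapeOf_eq (T : ℤ → α) (h : ℤ) :
    tapeOf h (fun i => T (h - 1 - i)) (fun i => T (h + i)) = T := by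
  ext j
  rcases lt_or_ge j h with hj | hj
  · simp only [tapeOf, hj, if_true, Stream'.get]
    congr 1
    omega
  · simp only [tapeOf, hj.not_gt, if_false, Stream'.get]
    congr 1
    omega

end Zipper

/-! ### Processed cells and words of compound terms -/

section Dones

open Stream'

variable {G : Type u} {A : Type v} {M : DTM A (Token G)}

variable (M) in
/-- `k` cells marked as done. -/
abbrev dones (k : ℕ) : List (Sym M.k M.Γ) := List.replicate k (mark M .done)

theorem dones_succ_append (k : ℕ) (R : Stream' (Sym M.k M.Γ)) :
    dones M (k + 1) ++ₛ R = dones M k ++ₛ cons (mark M .done) R := by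
  rw [dones, List.replicate_succ', append_append_stream, cons_append_stream, nil_append_stream]

theorem dones_append_dones (j k : ℕ) (R : Stream' (Sym M.k M.Γ)) :
    dones M j ++ₛ (dones M k ++ₛ R) = dones M (j + k) ++ₛ R := by
  rw [← append_append_stream, List.replicate_append_replicate]

theorem table_term_done (m : Mode) :
    table M (.term m) (mark M .done) = [(.term m, mark M .done, 1)] := by
  cases m <;> simp [table, evalTable, skipTable, nextTable]

theorem map_token_node {cells : List (Sym M.k M.Γ)} {u w : List (Token G)} {y : Token G}
    (h : cells.map (token M) = ([Token.lpar] ++ u ++ [y] ++ w ++ [Token.rpar]).map some) :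
    ∃ c a x b z, cells = c :: (a ++ x :: (b ++ [z])) ∧ token M c = some .lpar ∧
      a.map (token M) = u.map some ∧ token M x = some y ∧ b.map (token M) = w.map some ∧
      token M z = some Token.rpar := by
  simp only [List.map_append, List.map_cons, List.map_nil, List.append_assoc,
    List.cons_append, List.nil_append] at h
  obtain ⟨c, l, rfl, hc, h⟩ := List.map_eq_cons_iff.1 h
  obtain ⟨a, l, rfl, ha, h⟩ := List.map_eq_append_iff.1 h
  obtain ⟨x, l, rfl, hx, h⟩ := List.map_eq_cons_iff.1 h
  obtain ⟨b, l, rfl, hb, h⟩ := List.map_eq_append_iff.1 h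
  obtain ⟨z, l, rfl, hz, h⟩ := List.map_eq_cons_iff.1 h
  obtain rfl := List.map_eq_nil_iff.1 h
  exact ⟨c, a, x, b, z, rfl, hc, ha, hx, hb, hz⟩

theorem node_append_stream (c x z : Sym M.k M.Γ) (a b : List (Sym M.k M.Γ))
    (R : Stream' (Sym M.k M.Γ)) :
    (c :: (a ++ x :: (b ++ [z]))) ++ₛ R = cons c (a ++ₛ cons x (b ++ₛ cons z R)) := by
  simp [cons_append_stream]

theorem length_node (c x z : Sym M.k M.Γ) (a b : List (Sym M.k M.Γ)) :
    (c :: (a ++ x :: (b ++ [z]))).length = a.length + b.length + 3 := by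
  simp
  omega

theorem node_cost (n i j : ℕ) : n + 4 * (i + j + 2) ^ 2 + 1 ≤ n + 4 * (i + j + 3) ^ 2 := by
  have : 4 * (i + j + 3) ^ 2 = 4 * (i + j + 2) ^ 2 + 8 * (i + j) + 20 := by ring
  omega

theorem table_next_add {x : Sym M.k M.Γ} (hx : token M x = some .add) :
    table M (.term .next) x = [(.back .add, mark M .done, -1)] := by
  simp [table, hx, nextTable]

theorem table_next_mul {x : Sym M.k M.Γ} (hx : token M x = some .mul) :
    table M (.term .next) x = [(.back .mul, mark M .done, -1)] := by
  simp [table, hx, nextTable]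

theorem exists_eq_singleton {cells : List (Sym M.k M.Γ)} {b : Token G}
    (h : cells.map (token M) = [b].map some) : ∃ c, cells = [c] ∧ token M c = some b := by
  simpa [List.map_eq_cons_iff] using h

end Dones

/-! ### Evaluation of a term -/

section Evaluation

open Stream'

variable {S : Type u} [Semiring S] {G : Finset S} {A : Type v} {M : DTM A (Token G)}

variable (M) in
/-- `Yields` for the tape given by its parts to the left of the head and from the head on. -/
def ZYields (q : State M.k M.Q M.Γ) (L R : Stream' (Sym M.k M.Γ)) (s : S) (n : ℕ) : Prop :=
  ∀ h, Yields M q (tapeOf h L R) h s n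

variable {L R : Stream' (Sym M.k M.Γ)} {c : Sym M.k M.Γ} {s : S} {n : ℕ}

theorem ZYields.mono {q : State M.k M.Q M.Γ} {m : ℕ} (hy : ZYields M q L R s m) (hmn : m ≤ n) :
    ZYields M q L R s n :=
  fun h => (hy h).mono hmn

theorem zyields_right {q q' : State M.k M.Q M.Γ} {d : Sym M.k M.Γ} (hq : q ≠ .acc)
    (htr : table M q c = [(q', d, 1)]) (hd : d ≠ .blank)
    (hy : ZYields M q' (cons d L) R s n) :
    ZYields M q L (cons c R) (wt M q c * s) (n + 1) := by
  intro h
  have := yields_weighted (T := tapeOf h L (cons c R)) (h := h) hq (by simpa using htr) hd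
    (s := s) (n := n) (by simpa [update_tapeOf_right] using hy (h + 1))
  simpa using this

theorem zyields_left {q q' : State M.k M.Q M.Γ} {d l : Sym M.k M.Γ} (hq : q ≠ .acc)
    (htr : table M q c = [(q', d, -1)]) (hd : d ≠ .blank) (hw : wt M q c = 1)
    (hy : ZYields M q' L (cons l (cons d R)) s n) :
    ZYields M q (cons l L) (cons c R) s (n + 1) := by
  intro h
  exact yields_one (T := tapeOf h (cons l L) (cons c R)) (h := h) hq (by simpa using htr) hd
    (by simpa using hw) (by simpa [update_tapeOf_left, ← sub_eq_add_neg] using hy (h - 1))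

theorem zyields_none {q : State M.k M.Q M.Γ} (hq : q ≠ .acc) (htr : table M q c = []) :
    ZYields M q L (cons c R) 0 1 :=
  fun h => yields_none hq (by simpa using htr)

theorem zyields_lpar {s₁ s₂ s₃ : S} (hc : token M c = some .lpar)
    (h₁ : ZYields M (.term .eval) (cons (mark M .left) L) R s₁ n)
    (h₂ : ZYields M (.term .skip) (cons (mark M .right) L) R s₂ n)
    (h₃ : ZYields M (.term .eval) (cons (mark M .both) L) R s₃ n) :
    ZYields M (.term .eval) L (cons c R) (s₁ + s₂ + s₃) (n + 1) := by
  intro h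
  refine yields_lpar (by simpa using hc) ?_ ?_ ?_ <;> rw [update_tapeOf_right]
  exacts [h₁ _, h₂ _, h₃ _]

theorem wt_done (m : Mode) : wt M (.term m) (mark M .done) = 1 := by
  cases m <;> simp [wt]

theorem zyields_forward (m : Mode) (k : ℕ)
    (hy : ZYields M (.term m) (dones M k ++ₛ L) R s n) :
    ZYields M (.term m) L (dones M k ++ₛ R) s (n + k) := by
  induction k generalizing L with
  | zero => exact hy
  | succ k ih =>
    have := zyields_right (c := mark M .done) (L := L) (R := dones M k ++ₛ R) (n := n + k) (s := s)
      (by simp) (table_term_done m) (by simp [mark]) (ih (by rwa [← dones_succ_append]))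
    rw [wt_done, one_mul] at this
    exact this

/-- The cell `c` being read becomes done as well, hence `k + 1` done cells on arrival. The state `q`
is arbitrary because only the first move starts outside `.back o`. -/
theorem zyields_backward {q : State M.k M.Q M.Γ} {o : Cause} {f : Sym M.k M.Γ} (k : ℕ)
    (hq : q ≠ .acc) (htr : table M q c = [(.back o, mark M .done, -1)]) (hw : wt M q c = 1)
    (hy : ZYields M (.back o) L (cons f (dones M (k + 1) ++ₛ R)) s n) :
    ZYields M q (dones M k ++ₛ cons f L) (cons c R) s (n + k + 1) := by
  induction k generalizing q c R with
  | zero => exact zyields_left hq htr (by simp [mark]) hw hy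
  | succ k ih =>
    rw [show dones M (k + 1) = mark M .done :: dones M k from rfl, cons_append_stream]
    refine zyields_left hq htr (by simp [mark]) hw ?_
    refine ih (by simp) (by simp [table]) (by simp [wt]) ?_
    rwa [← dones_succ_append]

/-- The cost is `k + 1` moves back to the mark, one move on it, and `k + 1` moves forward over the
done cells. -/
theorem zyields_return {o : Cause} {f g : Mark} {m : Mode} (k : ℕ) (hf : f ≠ .done)
    (hr : resume o f = some (g, m))
    (htr : table M (.term .next) c = [(.back o, mark M .done, -1)])
    (hy : ZYields M (.term m) (dones M (k + 1) ++ₛ cons (mark M g) L) R s n) :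
    ZYields M (.term .next) (dones M k ++ₛ cons (mark M f) L) (cons c R) s (n + 2 * k + 3) := by
  have h₁ := zyields_forward m (k + 1) hy
  have h₂ := zyields_right (M := M) (q := .back o) (c := mark M f) (by simp)
    (by simp [table, hf, hr]) (by simp [mark]) h₁
  rw [show wt M (.back o) (mark M f) = 1 from rfl, one_mul] at h₂
  exact (zyields_backward k (by simp) htr rfl h₂).mono (by omega)

theorem zyields_reject {o : Cause} {f : Mark} (k : ℕ) (hf : f ≠ .done)
    (hr : resume o f = none)
    (htr : table M (.term .next) c = [(.back o, mark M .done, -1)]) :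
    ZYields M (.term .next) (dones M k ++ₛ cons (mark M f) L) (cons c R) 0 (k + 2) := by
  have h₂ := zyields_none (M := M) (q := .back o) (c := mark M f) (L := L)
    (R := dones M (k + 1) ++ₛ R) (by simp) (by simp [table, hf, hr])
  exact (zyields_backward k (by simp) htr rfl h₂).mono (by omega)

variable (M) in
/-- Started in mode `m` on the given cells, the machine turns them into done cells, with total
weight `v`. -/
def Processes (m : Mode) (cells : List (Sym M.k M.Γ)) (v : S) : Prop :=
  ∀ (L R : Stream' (Sym M.k M.Γ)) (s : S) (n : ℕ),
    ZYields M (.term .next) (dones M cells.length ++ₛ L) R s n →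
    ZYields M (.term m) L (cells ++ₛ R) (v * s) (n + 4 * cells.length ^ 2)

/-- The bracket is visited twice more: from the operator, to look up the guess, and from the closing
bracket, to become done itself. The cross terms of the square pay for both trips. -/
theorem Processes.node {o : Cause} {f g : Mark} {m m' : Mode} {a b : List (Sym M.k M.Γ)}
    {x z : Sym M.k M.Γ} {v v' : S} (ha : Processes M m a v) (hb : Processes M m' b v')
    (hf : f ≠ .done) (hg : g ≠ .done) (hr : resume o f = some (g, m'))
    (hx : table M (.term .next) x = [(.back o, mark M .done, -1)])
    (hz : token M z = some .rpar)
    (hy : ZYields M (.term .next) (dones M (a.length + b.length + 3) ++ₛ L) R s n) :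
    ZYields M (.term m) (cons (mark M f) L) (a ++ₛ cons x (b ++ₛ cons z R)) (v * (v' * s))
      (n + 4 * (a.length + b.length + 2) ^ 2) := by
  have h₁ : ZYields M (.term .next)
      (dones M (b.length + (a.length + 1)) ++ₛ cons (mark M g) L) (cons z R) s _ :=
    zyields_return (o := .close) (c := z) (f := g) (g := .done) (m := .next) (n := n) _ hg
      (by cases g <;> rfl) (by simp [table, hz, nextTable]) <| by
      rwa [← dones_succ_append, show b.length + (a.length + 1) + 1 + 1 =
        a.length + b.length + 3 by omega]
  rw [← dones_append_dones] at h₁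
  have h₂ := ha _ _ _ _ (zyields_return _ hf hr hx (hb _ _ _ _ h₁))
  refine h₂.mono ?_
  have : 4 * (a.length + b.length + 2) ^ 2 = 4 * a.length ^ 2 + 4 * b.length ^ 2 +
    8 * (a.length * b.length) + 16 * a.length + 16 * b.length + 16 := by ring
  omega

/-- A wrong guess is discovered at the operator, before the second operand is read. The numbers `b`
and `n` only pad the bound to that of the successful branch. -/
theorem Processes.node_reject {o : Cause} {f : Mark} {m : Mode} {a : List (Sym M.k M.Γ)}
    {x : Sym M.k M.Γ} {v : S} (ha : Processes M m a v) (hf : f ≠ .done)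
    (hr : resume o f = none)
    (hx : table M (.term .next) x = [(.back o, mark M .done, -1)]) (b n : ℕ) :
    ZYields M (.term m) (cons (mark M f) L) (a ++ₛ cons x R) 0
      (n + 4 * (a.length + b + 2) ^ 2) := by
  have h₂ := ha _ _ _ _ (zyields_reject (L := L) (R := R) a.length hf hr hx)
  rw [mul_zero] at h₂
  refine h₂.mono ?_
  have : 4 * (a.length + b + 2) ^ 2 = 4 * a.length ^ 2 + 4 * b ^ 2 +
    8 * (a.length * b) + 16 * a.length + 16 * b + 16 := by ring
  omega

theorem processes_of_step {c : Sym M.k M.Γ} {m : Mode}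
    (htr : table M (.term m) c = [(.term .next, mark M .done, 1)]) :
    Processes M m [c] (wt M (.term m) c) := by
  intro L R s n hy
  exact (zyields_right (by simp) htr (by simp [mark]) hy).mono (by simp)

theorem processes_skip_node {c x z : Sym M.k M.Γ} {a b : List (Sym M.k M.Γ)} {o : Cause}
    (hc : token M c = some .lpar) (hr : resume o .skip = some (.skip, .skip))
    (hx : table M (.term .next) x = [(.back o, mark M .done, -1)])
    (hz : token M z = some .rpar)
    (ha : Processes M .skip a (1 : S)) (hb : Processes M .skip b (1 : S)) :
    Processes M .skip (c :: (a ++ x :: (b ++ [z]))) (1 : S) := by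
  intro L R s n hy
  rw [length_node] at hy ⊢
  rw [node_append_stream]
  have := zyields_right (M := M) (q := .term .skip) (c := c) (by simp)
    (by simp [table, hc, skipTable]) (by simp [mark]) (ha.node hb (by simp) (by simp) hr hx hz hy)
  simp only [one_mul, show wt M (.term .skip) c = 1 from rfl] at this
  simpa using this.mono (node_cost _ _ _)

theorem processes_skip (t : SemiringTerm G) (cells : List (Sym M.k M.Γ))
    (hcells : cells.map (token M) = t.word.map some) : Processes M .skip cells (1 : S) := by
  induction t generalizing cells with
  | gen g =>
    obtain ⟨c, rfl, hc⟩ := exists_eq_singleton hcells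
    exact processes_of_step (by simp [table, hc, skipTable])
  | zero =>
    obtain ⟨c, rfl, hc⟩ := exists_eq_singleton hcells
    exact processes_of_step (by simp [table, hc, skipTable])
  | one =>
    obtain ⟨c, rfl, hc⟩ := exists_eq_singleton hcells
    exact processes_of_step (by simp [table, hc, skipTable])
  | add s t ihs iht =>
    obtain ⟨c, a, x, b, z, rfl, hc, ha, hx, hb, hz⟩ := map_token_node hcells
    exact processes_skip_node hc rfl (table_next_add hx) hz (ihs a ha) (iht b hb)
  | mul s t ihs iht =>
    obtain ⟨c, a, x, b, z, rfl, hc, ha, hx, hb, hz⟩ := map_token_node hcells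
    exact processes_skip_node hc rfl (table_next_mul hx) hz (ihs a ha) (iht b hb)

theorem processes_eval (t : SemiringTerm G) (cells : List (Sym M.k M.Γ))
    (hcells : cells.map (token M) = t.word.map some) : Processes M .eval cells t.eval := by
  induction t generalizing cells with
  | gen g =>
    obtain ⟨c, rfl, hc⟩ := exists_eq_singleton hcells
    have := processes_of_step (M := M) (c := c) (m := .eval) (by simp [table, hc, evalTable])
    simpa [wt, hc, SemiringTerm.eval] using this
  | zero =>
    obtain ⟨c, rfl, hc⟩ := exists_eq_singleton hcells
    intro L R s n _
    have := zyields_none (M := M) (q := .term .eval) (c := c) (L := L) (R := R) (by simp)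
      (by simp [table, hc, evalTable])
    rw [SemiringTerm.eval, zero_mul]
    exact this.mono (by simp)
  | one =>
    obtain ⟨c, rfl, hc⟩ := exists_eq_singleton hcells
    have := processes_of_step (M := M) (c := c) (m := .eval) (by simp [table, hc, evalTable])
    simpa [wt, hc, SemiringTerm.eval] using this
  | add s t ihs iht =>
    obtain ⟨c, a, x, b, z, rfl, hc, ha, hx, hb, hz⟩ := map_token_node hcells
    intro L R s' n hy
    rw [length_node] at hy ⊢
    rw [node_append_stream]
    have hx := table_next_add hx
    -- The guesses left, right and both contribute the first summand, the second summand and 0.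
    have key := zyields_lpar (L := L) hc
      ((ihs a ha).node (processes_skip t b hb) (by simp) (by simp) rfl hx hz hy)
      ((processes_skip s a ha).node (iht b hb) (by simp) (by simp) rfl hx hz hy)
      ((ihs a ha).node_reject (by simp) rfl hx b.length n)
    simpa [SemiringTerm.eval, add_mul] using key.mono (node_cost _ _ _)
  | mul s t ihs iht =>
    obtain ⟨c, a, x, b, z, rfl, hc, ha, hx, hb, hz⟩ := map_token_node hcells
    intro L R s' n hy
    rw [length_node] at hy ⊢
    rw [node_append_stream]
    have hx := table_next_mul hx
    -- Here only the guess "both" survives.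
    have key := zyields_lpar (L := L) hc
      ((ihs a ha).node_reject (by simp) rfl hx b.length n)
      ((processes_skip (S := S) s a ha).node_reject (by simp) rfl hx b.length n)
      ((ihs a ha).node (iht b hb) (by simp) (by simp) rfl hx hz hy)
    simpa [SemiringTerm.eval, mul_assoc] using key.mono (node_cost _ _ _)

/-- The machine evaluates a term whose word is followed by a symbol outside words. -/
theorem zyields_eval (t : SemiringTerm G) (cells : List (Sym M.k M.Γ))
    (hcells : cells.map (token M) = t.word.map some) (hc : token M c = none)
    (hc' : (view M c).1 ≠ .done) :
    ZYields M (.term .eval) L (cells ++ₛ cons c R) t.eval (4 * cells.length ^ 2 + 1) := by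
  have h := zyields_right (M := M) (q := .term .next) (c := c) (R := R) (n := 0) (s := (1 : S))
    (L := dones M cells.length ++ₛ L) (by simp)
    (by rw [table, hc, nextTable, if_neg hc']) (by simp [keep]) fun h => yields_acc _ h
  have := processes_eval t cells hcells L (cons c R) _ _ h
  simpa [wt, add_comm] using this

end Evaluation

/-! ### Several tapes as tracks of one tape -/

section Represents

variable {G : Type u} {A : Type v} {M : DTM A (Token G)}

variable (M) in
/-- The tape `T` holds the vector `W j` in cell `j`, the cell `0` carries the mark `center`, and
exactly the cells from `-a` to `b` have been written or contain an input letter. -/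
structure Represents (T : ℤ → Sym M.k M.Γ) (W : ℤ → Fin (M.k + 2) → M.Γ) (a b : ℕ) : Prop where
  view_eq : ∀ j, view M (T j) = (if j = 0 then .center else .plain, W j)
  eq_blank : ∀ j, T j = .blank ↔ j < -a ∨ b < j

variable {T : ℤ → Sym M.k M.Γ} {W : ℤ → Fin (M.k + 2) → M.Γ} {a b : ℕ}

theorem Represents.apply_eq_blank (hT : Represents M T W a b) {j : ℤ} (hj : j < -a ∨ b < j) :
    W j = fun _ => M.blank := by
  have h := hT.view_eq j
  rw [(hT.eq_blank j).2 hj] at h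
  exact (congrArg Prod.snd h).symm

/-- Condition `hab` says that the used interval grows by the cell `h`, or stays the same if `h`
already lies in it. -/
theorem Represents.update (hT : Represents M T W a b) {h : ℤ} {f : Mark}
    {v : Fin (M.k + 2) → M.Γ} {a' b' : ℕ} (hf : f = if h = 0 then .center else .plain)
    (hab : ∀ j : ℤ, (j < -a' ∨ b' < j) ↔ j ≠ h ∧ (j < -a ∨ b < j)) :
    Represents M (Function.update T h (.cell f v)) (Function.update W h v) a' b' := by
  refine ⟨fun j => ?_, fun j => ?_⟩
  · rcases eq_or_ne j h with rfl | hj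
    · simp [view, hf]
    · simp [hj, hT.view_eq]
  · rw [hab]
    rcases eq_or_ne j h with rfl | hj
    · simp
    · simp [hj, hT.eq_blank]

theorem Represents.update_keep (hT : Represents M T W a b) {h : ℤ} {a' b' : ℕ}
    (hab : ∀ j : ℤ, (j < -a' ∨ b' < j) ↔ j ≠ h ∧ (j < -a ∨ b < j)) :
    Represents M (Function.update T h (keep M (T h))) W a' b' := by
  have := hT.update (h := h) (f := (view M (T h)).1) (v := W h) (by rw [hT.view_eq]) hab
  rw [Function.update_eq_self] at this
  rwa [keep, show (view M (T h)).2 = W h by rw [hT.view_eq]]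

/-- Shift to the right the tapes whose heads are to be moved to the left. -/
def shiftRight (m : Fin (M.k + 2) → SignType) (W : ℤ → Fin (M.k + 2) → M.Γ) :
    ℤ → Fin (M.k + 2) → M.Γ :=
  fun j i => if m i = -1 then W (j - 1) i else W j i

/-- Shift to the left the tapes whose heads are to be moved to the right. -/
def shiftLeft (m : Fin (M.k + 2) → SignType) (W : ℤ → Fin (M.k + 2) → M.Γ) :
    ℤ → Fin (M.k + 2) → M.Γ :=
  fun j i => if m i = 1 then W (j + 1) i else W j i

theorem shiftLeft_shiftRight (m : Fin (M.k + 2) → SignType) (W : ℤ → Fin (M.k + 2) → M.Γ) :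
    shiftLeft m (shiftRight m W) = fun j i => W (j + m i) i := by
  ext j i
  cases hm : m i
  · simp [shiftLeft, shiftRight, hm]
  · simp [shiftLeft, shiftRight, hm, ← sub_eq_add_neg]
  · simp [shiftLeft, shiftRight, hm]

variable (M) in
/-- The contents of the tapes relative to the head positions. -/
def vectors (C : M.Cfg) : ℤ → Fin (M.k + 2) → M.Γ := fun j i => C.tape i (C.head i + j)

/-- Relative to its head, a tape moves opposite to the head movement; each track undergoes at most
one of the two shifts. -/
theorem vectors_step {C C' : M.Cfg} {q : M.Q} {v : Fin (M.k + 2) → M.Γ}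
    {m : Fin (M.k + 2) → SignType}
    (hδ : M.δ C.state (vectors M C 0) = some (q, v, m)) (hC : M.step C = some C') :
    C'.state = q ∧
      vectors M C' = shiftLeft m (shiftRight m (Function.update (vectors M C) 0 v)) := by
  have h₀ : (fun i => C.tape i (C.head i)) = vectors M C 0 :=
    funext fun i => congrArg (C.tape i) (add_zero _).symm
  rw [DTM.step, h₀, hδ] at hC
  simp only [Option.map_some, Option.some.injEq] at hC
  subst hC
  refine ⟨rfl, ?_⟩
  rw [shiftLeft_shiftRight]
  ext j i
  rcases eq_or_ne (j + (m i : ℤ)) 0 with h | h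
  · simp [vectors, h, show C.head i + (m i : ℤ) + j = C.head i by omega]
  · rw [Function.update_of_ne h]
    simp only [vectors]
    rw [Function.update_of_ne (by omega)]
    congr 1
    omega

end Represents

/-! ### Simulation of one step -/

section Steps

variable {S : Type u} [Semiring S] {G : Finset S} {A : Type v} {M : DTM A (Token G)}
  {T : ℤ → Sym M.k M.Γ} {W : ℤ → Fin (M.k + 2) → M.Γ} {a b : ℕ} {s : S} {n : ℕ}

variable (M) in
/-- `Yields` for all tapes which represent `W`. -/
def RYields (q : State M.k M.Q M.Γ) (W : ℤ → Fin (M.k + 2) → M.Γ) (a b : ℕ) (h : ℤ) (s : S)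
    (n : ℕ) : Prop :=
  ∀ T, Represents M T W a b → Yields M q T h s n

/-- The left end is recognised by its blank, which is overwritten on arrival; hence `a + 1`
afterwards. -/
theorem ryields_toLeft (r : Option (M.Q × (Fin (M.k + 2) → SignType))) (k : ℕ) {h : ℤ}
    (hh : h = -a - 1 + k) (hb : h ≤ b)
    (hy : RYields M (afterLeft M r) W (a + 1) b (-a - 1) s n) :
    RYields M (.toLeft r) W a b h s (n + k + 1) := by
  induction k generalizing h with
  | zero =>
    intro T hT
    have hblank : T h = .blank := (hT.eq_blank h).2 (by omega)
    refine yields_one (m := 0) (by simp) (by rw [table, if_pos hblank]) (by simp [keep]) rfl ?_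
    have := hy _ (hT.update_keep (h := h) (by omega))
    simpa [hh] using this
  | succ k ih =>
    intro T hT
    have hblank : T h ≠ .blank := (hT.eq_blank h).not.2 (by omega)
    refine yields_one (m := -1) (by simp) (by rw [table, if_neg hblank]) (by simp [keep]) rfl ?_
    exact ih (h := h + (-1)) (by push_cast at hh; omega) (by omega) _
      (hT.update_keep (h := h) (by omega))

theorem ryields_sim_scan (q : M.Q) (k : ℕ) {h : ℤ} (hh : h = -k) (ha : k ≤ a)
    (hy : RYields M (.sim q) W a b 0 s n) : RYields M (.sim q) W a b h s (n + k) := by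
  induction k generalizing h with
  | zero => simpa [hh] using hy
  | succ k ih =>
    intro T hT
    have hc : (view M (T h)).1 ≠ .center := by
      rw [hT.view_eq, if_neg (by omega)]
      simp
    refine yields_one (m := 1) (by simp) (by rw [table, if_neg hc]) (by simp [keep]) rfl ?_
    exact ih (h := h + 1) (by push_cast at hh; omega) (by omega) _
      (hT.update_keep (h := h) (by omega))

theorem ryields_term_scan (k : ℕ) {h : ℤ} (ha : -a ≤ h) (hb : h + k ≤ b)
    (hW : ∀ j, h ≤ j → j < h + k → W j (Fin.last (M.k + 1)) = M.blank)
    (hy : RYields M (.term .eval) W a b (h + k) s n) :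
    RYields M (.term .eval) W a b h s (n + k) := by
  induction k generalizing h with
  | zero => simpa using hy
  | succ k ih =>
    intro T hT
    have hc : token M (T h) = none :=
      token_eq_none M (by rw [hT.view_eq]; exact hW h le_rfl (by omega))
    refine yields_one (m := 1) (by simp) (by rw [table, hc, evalTable]) (by simp [keep])
      (by simp [wt, hc]) ?_
    push_cast at hb hW hy
    refine ih (h := h + 1) (by omega) (by omega) (fun j _ _ => hW j (by omega) (by omega)) ?_ _
      (hT.update_keep (h := h) (by omega))
    rwa [add_right_comm, add_assoc]

/-- Sweep invariant: the tracks are already shifted to the left of `h`, while the state remembers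
the unshifted vector of cell `h - 1`. -/
theorem ryields_sweepRight_of (q : M.Q) (m : Fin (M.k + 2) → SignType) (k : ℕ) {h : ℤ}
    (hh : h + k = b + 1) (ha : -a ≤ h) (hW : ∀ j : ℤ, b < j → W j = fun _ => M.blank)
    (hy : RYields M (.sweepLeft q m fun _ => M.blank) (shiftRight m W) a (b + 1) (b + 1) s n) :
    RYields M (.sweepRight q m (W (h - 1))) (fun j => if j < h then shiftRight m W j else W j)
      a b h s (n + k + 1) := by
  induction k generalizing h with
  | zero =>
    intro T hT
    obtain rfl : h = b + 1 := by simpa using hh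
    have hblank : T (b + 1) = .blank := (hT.eq_blank _).2 (by omega)
    have hv : (view M (T (b + 1))).2 = W (b + 1) := by simp [hT.view_eq]
    refine yields_one (m := 0) (d := .cell (view M (T (b + 1))).1 (shiftRight m W (b + 1)))
      (by simp) (by rw [table, if_pos hblank, hv]; rfl) (by simp) rfl ?_
    rw [SignType.coe_zero, add_zero]
    refine hy _ ?_
    convert hT.update (h := b + 1) (f := (view M (T (b + 1))).1) (v := shiftRight m W (b + 1))
      (a' := a) (b' := b + 1)
      (by rw [hT.view_eq]) (by omega) using 1
    ext j : 1
    rcases lt_trichotomy j (b + 1) with hj | rfl | hj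
    · rw [Function.update_of_ne hj.ne, if_pos hj]
    · rw [Function.update_self]
    · rw [Function.update_of_ne hj.ne', if_neg hj.not_gt]
      ext i
      simp [shiftRight, hW j (by omega), hW (j - 1) (by omega)]
  | succ k ih =>
    intro T hT
    have hblank : T h ≠ .blank := (hT.eq_blank h).not.2 (by omega)
    have hv : (view M (T h)).2 = W h := by simp [hT.view_eq]
    refine yields_one (m := 1) (d := .cell (view M (T h)).1 (shiftRight m W h))
      (by simp) (by rw [table, if_neg hblank, hv]; rfl) (by simp) rfl ?_
    have := ih (h := h + 1) (by push_cast at hh; omega) (by omega)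
    rw [add_sub_cancel_right] at this
    refine this _ ?_
    convert hT.update (h := h) (f := (view M (T (h))).1) (v := shiftRight m W h) (a' := a) (b' := b)
      (by rw [hT.view_eq]) (by omega) using 1
    ext j : 1
    rcases lt_trichotomy j h with hj | rfl | hj
    · rw [Function.update_of_ne hj.ne, if_pos hj, if_pos (by omega)]
    · rw [Function.update_self, if_pos (by omega)]
    · rw [Function.update_of_ne hj.ne', if_neg hj.not_gt, if_neg (by omega)]

theorem ryields_sweepRight (q : M.Q) (m : Fin (M.k + 2) → SignType)
    (hy : RYields M (.sweepLeft q m fun _ => M.blank) (shiftRight m W) a (b + 1) (b + 1) s n) :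
    RYields M (.sweepRight q m fun _ => M.blank) W a b (-a) s (n + (a + b + 1) + 1) := by
  intro T hT
  have h := ryields_sweepRight_of q m (a + b + 1) (h := -a) (by push_cast; omega) le_rfl
    (fun j hj => hT.apply_eq_blank (.inr hj)) hy
  rw [hT.apply_eq_blank (j := -a - 1) (by omega)] at h
  refine h T ?_
  convert hT using 1
  ext j : 1
  -- Left of `-a` all vectors are blank, so shifting them changes nothing and the invariant holds at
  -- the start.
  split_ifs with hj
  · ext i
    simp [shiftRight, hT.apply_eq_blank (.inl hj), hT.apply_eq_blank (j := j - 1) (by omega)]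
  · rfl

theorem ryields_sweepLeft_of (q : M.Q) (m : Fin (M.k + 2) → SignType) (k : ℕ) {h : ℤ}
    (hh : h - k = -a - 1) (hb : h ≤ b) (hW : ∀ j : ℤ, j < -a → W j = fun _ => M.blank)
    (hy : RYields M (.sim q) (shiftLeft m W) (a + 1) b (-a - 1) s n) :
    RYields M (.sweepLeft q m (W (h + 1))) (fun j => if h < j then shiftLeft m W j else W j)
      a b h s (n + k + 1) := by
  induction k generalizing h with
  | zero =>
    intro T hT
    obtain rfl : h = -a - 1 := by simpa using hh
    have hblank : T (-a - 1) = .blank := (hT.eq_blank _).2 (by omega)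
    have hv : (view M (T (-a - 1))).2 = W (-a - 1) := by simp [hT.view_eq]
    refine yields_one (m := 0) (d := .cell (view M (T (-a - 1))).1 (shiftLeft m W (-a - 1)))
      (by simp) (by rw [table, if_pos hblank, hv]; rfl) (by simp) rfl ?_
    rw [SignType.coe_zero, add_zero]
    refine hy _ ?_
    convert hT.update (h := -a - 1) (f := (view M (T (-a - 1))).1) (v := shiftLeft m W (-a - 1))
      (a' := a + 1) (b' := b)
      (by rw [hT.view_eq]) (by omega) using 1
    ext j : 1
    rcases lt_trichotomy j (-a - 1) with hj | rfl | hj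
    · rw [Function.update_of_ne hj.ne, if_neg hj.not_gt]
      ext i
      simp [shiftLeft, hW j (by omega), hW (j + 1) (by omega)]
    · rw [Function.update_self]
    · rw [Function.update_of_ne hj.ne', if_pos hj]
  | succ k ih =>
    intro T hT
    have hblank : T h ≠ .blank := (hT.eq_blank h).not.2 (by omega)
    have hv : (view M (T h)).2 = W h := by simp [hT.view_eq]
    refine yields_one (m := -1) (d := .cell (view M (T h)).1 (shiftLeft m W h))
      (by simp) (by rw [table, if_neg hblank, hv]; rfl) (by simp) rfl ?_
    have := ih (h := h - 1) (by push_cast at hh; omega) (by omega)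
    rw [sub_add_cancel] at this
    refine this _ ?_
    convert hT.update (h := h) (f := (view M (T (h))).1) (v := shiftLeft m W h) (a' := a) (b' := b)
      (by rw [hT.view_eq]) (by omega) using 1
    ext j : 1
    rcases lt_trichotomy j h with hj | rfl | hj
    · rw [Function.update_of_ne hj.ne, if_neg hj.not_gt, if_neg (by omega)]
    · rw [Function.update_self, if_pos (by omega)]
    · rw [Function.update_of_ne hj.ne', if_pos hj, if_pos (by omega)]

theorem ryields_sweepLeft (q : M.Q) (m : Fin (M.k + 2) → SignType)
    (hy : RYields M (.sim q) (shiftLeft m W) (a + 1) b (-a - 1) s n) :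
    RYields M (.sweepLeft q m fun _ => M.blank) W a b b s (n + (a + b + 1) + 1) := by
  intro T hT
  have h := ryields_sweepLeft_of q m (a + b + 1) (h := b) (by push_cast; omega) le_rfl
    (fun j hj => hT.apply_eq_blank (.inl hj)) hy
  rw [hT.apply_eq_blank (j := b + 1) (by omega)] at h
  refine h T ?_
  convert hT using 1
  ext j : 1
  split_ifs with hj
  · ext i
    simp [shiftLeft, hT.apply_eq_blank (.inr hj), hT.apply_eq_blank (j := j + 1) (by omega)]
  · rfl

/-- The walk to the left end and the sweep to the left each add a cell on the left, and the sweep to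
the right adds one on the right: hence `a + 2` and `b + 1`. The cost is four passes over the
interval or its left half. -/
theorem ryields_step {C C' : M.Cfg} (hC : M.step C = some C')
    (hy : RYields M (.sim C'.state) (vectors M C') (a + 2) (b + 1) 0 s n) :
    RYields M (.sim C.state) (vectors M C) a b 0 s (n + (4 * a + 2 * b + 12)) := by
  have h₀ : (fun i => C.tape i (C.head i)) = vectors M C 0 :=
    funext fun i => congrArg (C.tape i) (add_zero _).symm
  obtain ⟨q, v, m, hδ⟩ : ∃ q v m, M.δ C.state (vectors M C 0) = some (q, v, m) := by
    rw [DTM.step, h₀] at hC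
    rcases h : M.δ C.state (vectors M C 0) with _ | ⟨q, v, m⟩
    · simp [h] at hC
    · exact ⟨q, v, m, rfl⟩
  obtain ⟨rfl, hvec⟩ := vectors_step hδ hC
  rw [hvec] at hy
  have h₁ := ryields_sim_scan _ (a + 2) (h := -((a + 1 : ℕ) : ℤ) - 1)
    (by push_cast; omega) le_rfl hy
  have h₂ := ryields_sweepRight _ _ (ryields_sweepLeft _ _ h₁)
  have h₃ := ryields_toLeft (a := a) (b := b) (some (C'.state, m)) a (h := -1) (by omega) (by omega)
    (by simpa only [afterLeft, Nat.cast_add, Nat.cast_one, neg_add'] using h₂)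
  intro T hT
  have hv : view M (T 0) = (.center, vectors M C 0) := by rw [hT.view_eq, if_pos rfl]
  refine (yields_one (m := -1) (d := .cell .center v) (by simp)
    (by simp [table, hv, hδ]) (by simp) rfl (h₃ _ ?_)).mono (by omega)
  exact hT.update (by simp) (by omega)

end Steps

end Simulation

theorem wordTape_add {A Γ : Type*} (blank : Γ) (letter : A → Γ) (w : List A) (i : ℕ) :
    wordTape blank letter w i = (w.map letter).getD i blank := by
  simp [wordTape]

namespace SemiringTerm

theorem word_length_pos {G : Type u} (t : SemiringTerm G) : 0 < t.word.length := by
  cases t <;> simp [word]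

end SemiringTerm

namespace Simulation

/-! ### The initial configuration -/

section Init

variable {G : Type u} {A : Type v} {M : DTM A (Token G)}

theorem iterate_step_none (n : ℕ) : (fun o => o.bind M.step)^[n] none = none := by
  induction n with
  | zero => rfl
  | succ n ih => simpa using ih

/-- The first transition writes cell 0, so the truncated bound `w.length - 1` is also right for the
empty word. -/
theorem represents_init (w : List A) :
    Represents M (Function.update (wordTape .blank (fun x => .raw (M.inLetter x)) w) 0
      (.cell .center (view M (wordTape .blank (fun x => .raw (M.inLetter x)) w 0)).2))
      (vectors M (M.init w)) 0 (w.length - 1) := by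
  have hview : ∀ j : ℤ, view M (wordTape .blank (fun x => .raw (M.inLetter x)) w j) =
      (.plain, vectors M (M.init w) j) := by
    intro j
    have hvec : vectors M (M.init w) j =
        fun i => if i = 0 then wordTape M.blank M.inLetter w j else M.blank := by
      ext i
      by_cases hi : i = 0 <;> simp [vectors, DTM.init, hi]
    rw [hvec, wordTape, wordTape]
    split_ifs with hj
    · rcases lt_or_ge j.toNat w.length with h | h <;> simp [h, view]
    · simp [view]
  refine ⟨fun j => ?_, fun j => ?_⟩
  · rcases eq_or_ne j 0 with rfl | hj
    · rw [Function.update_self, hview, if_pos rfl]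
      rfl
    · simp [hj, hview]
  · rcases eq_or_ne j 0 with rfl | hj
    · simp
    · rw [Function.update_of_ne hj, wordTape]
      split_ifs with h
      · rcases lt_or_ge j.toNat w.length with h' | h'
        · simp [h']
          omega
        · simp [h']
          omega
      · simp
        omega

end Init

/-! ### From the end of the simulation to the value of the term -/

section Halt

variable {S : Type u} [Semiring S] {G : Finset S} {A : Type v} {M : DTM A (Token G)}
  {W : ℤ → Fin (M.k + 2) → M.Γ} {a b : ℕ}

/-- The cell after the word has no token and is not marked as done, so it serves as the end marker
required by `zyields_eval`. -/
theorem ryields_word (t : SemiringTerm G) {h : ℤ}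
    (hW : ∀ i : ℕ, W (h + i) (Fin.last (M.k + 1)) = (t.word.map M.outLetter).getD i M.blank) :
    RYields M (.term .eval) W a b h t.eval (4 * t.word.length ^ 2 + 1) := by
  intro T hT
  set R : Stream' (Sym M.k M.Γ) := fun i => T (h + i) with hR
  set ℓ := t.word.length
  have htok : ∀ i : ℕ, token M (T (h + i)) = t.word[i]? := by
    intro i
    rcases lt_or_ge i t.word.length with hi | hi
    · rw [List.getElem?_eq_getElem hi]
      refine token_eq_some M ?_
      rw [hT.view_eq]
      refine (hW i).trans ?_
      simp [hi]
    · rw [List.getElem?_eq_none hi]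
      refine token_eq_none M ?_
      rw [hT.view_eq]
      refine (hW i).trans ?_
      simp [hi]
  have hcells : (R.take ℓ).map (token M) = t.word.map some := by
    refine List.ext_getElem (by simp [ℓ]) fun i h₁ h₂ => ?_
    have hi : i < t.word.length := by simpa using h₂
    simp only [List.getElem_map, Stream'.take_get]
    rw [show R.get i = T (h + i) from rfl, htok, List.getElem?_eq_getElem hi]
  have hsplit : R = R.take ℓ ++ₛ Stream'.cons (T (h + ℓ)) (R.drop (ℓ + 1)) := by
    conv_lhs => rw [← Stream'.append_take_drop ℓ R]
    congr 1
    rw [← Stream'.eta (R.drop ℓ)]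
    congr 1
    · simp [hR, Stream'.head, Stream'.drop, Stream'.get]
    · rw [Stream'.tail_drop']
  have key := zyields_eval (M := M) (L := fun i => T (h - 1 - i)) (R := R.drop (ℓ + 1)) t _ hcells
    (c := T (h + ℓ)) (by simp [htok, ℓ]) (by rw [hT.view_eq]; dsimp only; split_ifs <;> simp)
  rw [← hsplit] at key
  have := key h
  rw [tapeOf_eq] at this
  simpa [ℓ] using this

/-- The number of steps needed from the end of the simulated computation on. -/
def haltCost (a b : ℕ) : ℕ := 4 * (a + b + 1) ^ 2 + (2 * a + b + 10)

theorem ryields_halt (t : SemiringTerm G) {C : M.Cfg} (hC : M.step C = none)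
    (hout : C.tape (Fin.last (M.k + 1)) = wordTape M.blank M.outLetter t.word) :
    RYields M (.sim C.state) (vectors M C) a b 0 t.eval (haltCost a b) := by
  have h₀ : (fun i => C.tape i (C.head i)) = vectors M C 0 :=
    funext fun i => congrArg (C.tape i) (add_zero _).symm
  have hδ : M.δ C.state (vectors M C 0) = none := by
    rwa [DTM.step, h₀, Option.map_eq_none_iff] at hC
  intro T hT
  have hlen := t.word_length_pos
  -- The output word starts at absolute cell 0, which is cell `-head` relative to the output head.
  set h : ℤ := -C.head (Fin.last (M.k + 1)) with hh
  have hW : ∀ j, vectors M C j (Fin.last (M.k + 1)) =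
      wordTape M.blank M.outLetter t.word (j - h) := by
    intro j
    rw [vectors, hout, hh, sub_neg_eq_add, add_comm]
  have hW' : ∀ i : ℕ, vectors M C (h + i) (Fin.last (M.k + 1)) =
      (t.word.map M.outLetter).getD i M.blank := by
    intro i
    rw [hW, add_sub_cancel_left, wordTape_add]
  -- Output letters are not blank, so the word lies in the used interval. This bounds its length by
  -- `a + b + 1`.
  have hne : ∀ i : ℕ, i < t.word.length → -a ≤ h + i ∧ h + i ≤ b := by
    intro i hi
    by_contra hcon
    have h₁ := hW' i
    rw [hT.apply_eq_blank (j := h + i) (by omega)] at h₁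
    simp only [List.getD_eq_getElem?_getD, List.getElem?_map, List.getElem?_eq_getElem hi,
      Option.map_some, Option.getD_some] at h₁
    exact M.outLetter_ne_blank _ h₁.symm
  have hfst := hne 0 hlen
  have hlst := hne (t.word.length - 1) (by omega)
  have h₁ := ryields_word (a := a + 1) (b := b) t hW'
  have h₂ := ryields_term_scan (M := M) (W := vectors M C) (a := a + 1) (b := b) (h := -a - 1)
    (h + a + 1).toNat (by push_cast; omega) (by omega) (by
      intro j _ hj
      rw [hW, wordTape, if_neg (by omega)])
    (by rwa [show (-a - 1 : ℤ) + (h + a + 1).toNat = h by omega])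
  have h₃ := ryields_toLeft (a := a) (b := b) none a (h := -1) (by omega) (by omega) h₂
  have hv : view M (T 0) = (.center, vectors M C 0) := by rw [hT.view_eq, if_pos rfl]
  refine (yields_one (m := -1) (d := keep M (T 0)) (by simp)
    (by simp [table, hv, hδ]) (by simp [keep]) rfl
    (h₃ _ (hT.update_keep (by omega)))).mono ?_
  have : t.word.length ^ 2 ≤ (a + b + 1) ^ 2 := Nat.pow_le_pow_left (by omega) 2
  rw [haltCost]
  omega

/-- The number of steps needed to simulate `n` steps and to evaluate the result. -/
def runCost (n a b : ℕ) : ℕ :=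
  haltCost (a + 2 * n) (b + n) + n * (4 * (a + 2 * n) + 2 * (b + n) + 12)

theorem ryields_run (t : SemiringTerm G) (n : ℕ) {C C' : M.Cfg}
    (hrun : (fun o => o.bind M.step)^[n] (some C) = some C') (hC : M.step C' = none)
    (hout : C'.tape (Fin.last (M.k + 1)) = wordTape M.blank M.outLetter t.word) :
    RYields M (.sim C.state) (vectors M C) a b 0 t.eval (runCost n a b) := by
  induction n generalizing C a b with
  | zero =>
    obtain rfl : C = C' := by simpa using hrun
    simpa [runCost] using ryields_halt t hC hout
  | succ n ih =>
    rw [Function.iterate_succ_apply, Option.bind_some] at hrun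
    rcases h : M.step C with _ | C₁
    · rw [h, iterate_step_none] at hrun
      cases hrun
    · rw [h] at hrun
      refine fun T hT => (ryields_step h (ih hrun) T hT).mono ?_
      rw [runCost, runCost, show a + 2 + 2 * n = a + 2 * (n + 1) by ring,
        show b + 1 + n = b + (n + 1) by ring]
      nlinarith

theorem machine_yields (t : SemiringTerm G) (w : List A) (n : ℕ)
    (h : M.OutputsIn w t.word n) :
    (machine M).Yields ((machine M).init w) t.eval (runCost n 0 w.length + 1) := by
  obtain ⟨C, hrun, hC, hout⟩ := h
  refine WTM.Yields.mono (m := runCost n 0 (w.length - 1) + 1) ?_ ?_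
  · change Yields M .init (wordTape .blank (fun x => .raw (M.inLetter x)) w) 0 _ _
    refine yields_one (m := 0) (by simp) (by rw [table]) (by simp) rfl ?_
    exact ryields_run t n hrun hC hout _ (represents_init w)
  · rw [runCost, runCost, haltCost, haltCost]
    gcongr <;> omega

end Halt

end Simulation

/-! ### Polynomial time bounds -/

theorem WTM.time_le_of_yields {S : Type u} [Semiring S] {A : Type v} {M : WTM S A} {r : List A → S}
    {B : ℕ → ℕ} (hB : Monotone B) (h : ∀ w, M.Yields (M.init w) (r w) (B w.length)) (n : ℕ) :
    M.time n ≤ B n := by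
  refine csSup_le ⟨_, [], by simp, rfl⟩ ?_
  rintro _ ⟨w, hw, rfl⟩
  refine csSup_le ⟨_, [], trivial, rfl⟩ ?_
  rintro _ ⟨γ, hγ, rfl⟩
  exact ((h w).length_le γ hγ).trans (hB hw)

theorem monotone_eval (p : Polynomial ℕ) : Monotone fun n => p.eval n := by
  intro m n hmn
  simp only [Polynomial.eval_eq_sum_range]
  gcongr

/-- The coefficients are natural numbers, so each monomial may be raised to the top degree. -/
theorem eval_le_eval_one_mul_pow (p : Polynomial ℕ) {n : ℕ} (hn : 1 ≤ n) :
    p.eval n ≤ p.eval 1 * n ^ p.natDegree := by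
  simp only [Polynomial.eval_eq_sum_range, one_pow, mul_one, Finset.sum_mul]
  refine Finset.sum_le_sum fun i hi => ?_
  gcongr
  exact Nat.lt_succ_iff.1 (Finset.mem_range.1 hi)

theorem mem_NP_of_yields {S : Type u} [Semiring S] {r : Series.{u, v} S} (M : WTM S r.1)
    (p : Polynomial ℕ) (h : ∀ w, M.Yields (M.init w) (r.2 w) (p.eval w.length)) :
    r ∈ NP.{u, v} S := by
  refine Set.mem_iUnion.2 ⟨p.natDegree, M, fun w => (h w).finite,
    funext fun w => (h w).value_eq, ?_⟩
  refine Asymptotics.IsBigO.of_bound (p.eval 1 : ℕ) (Filter.eventually_atTop.2 ⟨1, fun n hn => ?_⟩)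
  have hle : M.time n ≤ p.eval 1 * n ^ p.natDegree :=
    (WTM.time_le_of_yields (monotone_eval p) h n).trans (eval_le_eval_one_mul_pow p hn)
  rw [Real.norm_natCast, Real.norm_natCast]
  exact_mod_cast hle

end WeightedComplexity

theorem mainTheorem3 (S : Type u) [Semiring S] :
    WeightedComplexity.FP.{u, v} S ⊆ WeightedComplexity.NP.{u, v} S := by
  intro r hr
  obtain ⟨G, -, M, p, hM⟩ := Set.mem_iUnion.1 hr
  refine WeightedComplexity.mem_NP_of_yields (WeightedComplexity.Simulation.machine M)
    -- This is `runCost n 0 w.length + 1` with `p` for `n` and `X` for the length of `w`.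
    (4 * (2 * p + (Polynomial.X + p) + 1) ^ 2 + (2 * (2 * p) + (Polynomial.X + p) + 10) +
      p * (4 * (2 * p) + 2 * (Polynomial.X + p) + 12) + 1) fun w => ?_
  obtain ⟨t, n, hn, hout, ht⟩ := hM w
  rw [← ht]
  refine (WeightedComplexity.Simulation.machine_yields t w n hout).mono ?_
  simp only [WeightedComplexity.Simulation.runCost, WeightedComplexity.Simulation.haltCost,
    Polynomial.eval_add, Polynomial.eval_mul, Polynomial.eval_pow, Polynomial.eval_X, Polynomial.eval_one, Polynomial.eval_ofNat, zero_add]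
  gcongr
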